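/- Let $I$ be a nonempty totally ordered set, and let $\theta\ge 2$ be the order type of $\{0\}+I$ (ordinal sum). An $LM_\theta$-algebra is a bounded distributive lattice $\langle A,\vee,\wedge,0,1\rangle$ with unary operations $\phi_i,\overline{\phi}_i$ $(i\in I)$ such that, for all $i,j\in I$ and $x,y\in A$: $\phi_i$ is an endomorphism of the bounded lattice $A$; $\phi_i x\vee\overline{\phi}_i x=1$ and $\phi_i x\wedge\overline{\phi}_i x=0$; $\phi_i\phi_j x=\phi_j x$; $i\le j$ implies $\phi_i x\le\phi_j x$; and if $\phi_k x=\phi_k y$ for all $k\in I$ then $x=y$. A congruence on $A$ is an equivalence relation compatible with $\vee$, $\wedge$, all $\phi_i$ and all $\overline{\phi}_i$. Congruences, ordered by inclusion, form a bounded lattice, and a congruence is called Boolean if it has a complement in this lattice. For a filter $F$ of the lattice $A$, let $\boldsymbol{\Theta}(F)=\{(x,y)\in A\times A : x\wedge f=y\wedge f \text{ for some } f\in F\}$, and for $b\in A$ let $[b)=\{x\in A : b\le x\}$. Proposition. Let $A$ be an $LM_\theta$-algebra and let $\varphi$ be a congruence on $A$. Then the following conditions are equivalent: (i) $\varphi$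 is a Boolean congruence on $A$; (ii) there are $a\in A$ and $i\in I$ such that $\varphi=\boldsymbol{\Theta}([\phi_i a))$. -/

import Mathlib

universe u v

/-- A `θ`-valued Łukasiewicz–Moisil algebra on a bounded distributive lattice `A`, where `θ` is the
order type of `{0} + I` (ordinal sum) for a totally ordered set `I`. -/
class LMAlgebra (I : Type u) [LinearOrder I] (A : Type v) [DistribLattice A] [BoundedOrder A] where
  /-- The operations `φ_i`, endomorphisms of the bounded lattice `A`. -/
  phi : I → BoundedLatticeHom A A
  /-- The operations `φ̄_i`. -/
  phiBar : I → A → A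
  phi_sup_phiBar : ∀ (i : I) (x : A), phi i x ⊔ phiBar i x = ⊤
  phi_inf_phiBar : ∀ (i : I) (x : A), phi i x ⊓ phiBar i x = ⊥
  phi_phi : ∀ (i j : I) (x : A), phi i (phi j x) = phi j x
  phi_mono : ∀ (i j : I), i ≤ j → ∀ x : A, phi i x ≤ phi j x
  /-- The determination principle. -/
  determination : ∀ x y : A, (∀ i : I, phi i x = phi i y) → x = y

/-- A congruence on an LM-algebra: an equivalence relation compatible with all the operations
`⊓`, `⊔`, `φ_i`, `φ̄_i`. -/
structure LMCon (I : Type u) [LinearOrder I] (A : Type v) [DistribLattice A] [BoundedOrder A]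
    [LMAlgebra I A] extends LatticeCon A where
  phi : ∀ (i : I) {x y : A}, r x y → r (LMAlgebra.phi i x) (LMAlgebra.phi i y)
  phiBar : ∀ (i : I) {x y : A}, r x y → r (LMAlgebra.phiBar i x) (LMAlgebra.phiBar i y)

namespace LMCon

variable {I : Type u} [LinearOrder I] {A : Type v} [DistribLattice A] [BoundedOrder A]
  [LMAlgebra I A]

/-- Congruences are ordered by inclusion of relations. -/
instance : PartialOrder (LMCon I A) where
  le c d := ∀ ⦃x y : A⦄, c.r x y → d.r x y
  le_refl _ _ _ h := h
  le_trans _ _ _ h₁ h₂ _ _ h := h₂ (h₁ h)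
  le_antisymm c d h₁ h₂ := by
    obtain ⟨⟨⟨r, _⟩, _, _⟩, _, _⟩ := c
    obtain ⟨⟨⟨s, _⟩, _, _⟩, _, _⟩ := d
    have h : r = s := by
      funext x y
      exact propext ⟨fun h => h₁ h, fun h => h₂ h⟩
    subst h
    rfl

/-- The infimum of a set of congruences is their intersection. -/
instance : InfSet (LMCon I A) where
  sInf S :=
    { r := fun x y => ∀ c ∈ S, c.r x y
      iseqv :=
        ⟨fun x c _ => c.iseqv.refl x, fun h c hc => c.iseqv.symm (h c hc),
          fun h₁ h₂ c hc => c.iseqv.trans (h₁ c hc) (h₂ c hc)⟩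
      inf := fun h₁ h₂ c hc => c.inf (h₁ c hc) (h₂ c hc)
      sup := fun h₁ h₂ c hc => c.sup (h₁ c hc) (h₂ c hc)
      phi := fun i _ _ h c hc => c.phi i (h c hc)
      phiBar := fun i _ _ h c hc => c.phiBar i (h c hc) }

/-- The lattice of congruences, ordered by inclusion. -/
instance : CompleteLattice (LMCon I A) :=
  completeLatticeOfInf (LMCon I A) fun _ =>
    ⟨fun _ hc _ _ h => h _ hc, fun _ hd _ _ h _ hc => hd hc h⟩

/-- A congruence is Boolean if it is a Boolean (that is, complemented) element of the lattice of
congruences. -/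
def IsBoolean (c : LMCon I A) : Prop :=
  IsComplemented c

end LMCon

/-- The congruence `Θ(F)` associated with a filter `F` of a distributive lattice:
`(x, y) ∈ Θ(F)` iff `x ⊓ f = y ⊓ f` for some `f ∈ F`. -/
def filterCon {A : Type v} [DistribLattice A] (F : Order.PFilter A) : LatticeCon A where
  r x y := ∃ f ∈ F, x ⊓ f = y ⊓ f
  iseqv := by
    refine ⟨fun x => ?_, fun ⟨f, hf, h⟩ => ⟨f, hf, h.symm⟩, ?_⟩
    · obtain ⟨f, hf⟩ := F.nonempty
      exact ⟨f, hf, rfl⟩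
    · rintro x y z ⟨f, hf, h₁⟩ ⟨g, hg, h₂⟩
      refine ⟨f ⊓ g, Order.PFilter.inf_mem hf hg, ?_⟩
      rw [← inf_assoc, h₁, inf_right_comm, h₂, inf_right_comm, inf_assoc]
  inf := by
    rintro w x y z ⟨f, hf, h₁⟩ ⟨g, hg, h₂⟩
    refine ⟨f ⊓ g, Order.PFilter.inf_mem hf hg, ?_⟩
    rw [inf_inf_inf_comm, h₁, h₂, inf_inf_inf_comm]
  sup := by
    rintro w x y z ⟨f, hf, h₁⟩ ⟨g, hg, h₂⟩
    refine ⟨f ⊓ g, Order.PFilter.inf_mem hf hg, ?_⟩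
    rw [inf_sup_right, inf_sup_right, ← inf_assoc, h₁, inf_comm f g, ← inf_assoc y, h₂]
    simp only [inf_assoc, inf_comm g f]

namespace LMAlgebra

variable {I : Type u} [LinearOrder I] {A : Type v} [DistribLattice A] [BoundedOrder A]
  [LMAlgebra I A]

/-! The elements `phi i x` are complemented and fixed by every `phi j`. If `b` and `b'` are
complements of this kind, the congruences of `[b)` and `[b')` are complements (`isCompl_ofFixed`).
Conversely, if `c` and `d` are complements, `phiComp c d` lies above both and so is total. This
gives `z` with `⊥` `c`-related to `z` and `z` `d`-related to `⊤`, and `phiBar i z` generates the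
filter of `c` (`eq_filterCon_of_isCompl`). -/

theorem isCompl_phi_phiBar (i : I) (x : A) : IsCompl (phi i x) (phiBar i x) :=
  IsCompl.of_eq (phi_inf_phiBar i x) (phi_sup_phiBar i x)

theorem phi_phiBar (i j : I) (x : A) : phi i (phiBar j x) = phiBar j x := by
  have h : IsCompl (phi j x) (phi i (phiBar j x)) := by
    refine IsCompl.of_eq ?_ ?_
    · rw [← phi_phi i j x, ← map_inf, phi_inf_phiBar, map_bot]
    · rw [← phi_phi i j x, ← map_sup, phi_sup_phiBar, map_top]
  exact h.right_unique (isCompl_phi_phiBar j x)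

theorem phiBar_phi (i j : I) (x : A) : phiBar i (phi j x) = phiBar j x := by
  have h := isCompl_phi_phiBar i (phi j x)
  rw [phi_phi] at h
  exact h.right_unique (isCompl_phi_phiBar j x)

end LMAlgebra

namespace LMCon

open LMAlgebra

variable {I : Type u} [LinearOrder I] {A : Type v} [DistribLattice A] [BoundedOrder A]
  [LMAlgebra I A]

/-- Two congruences permute on the range of each `φ_i`. -/
theorem exists_rel_rel_of_rel_rel (c d : LMCon I A) {i : I} {x y z : A}
    (h₁ : c.r (LMAlgebra.phi i x) z) (h₂ : d.r z (LMAlgebra.phi i y)) :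
    ∃ w, c.r (LMAlgebra.phi i y) w ∧ d.r w (LMAlgebra.phi i x) := by
  have key (x y : A) : LMAlgebra.phi i x ⊓ LMAlgebra.phiBar i x ⊔
      (LMAlgebra.phi i y ⊓ LMAlgebra.phiBar i x ⊔ LMAlgebra.phi i x ⊓ LMAlgebra.phi i y) = LMAlgebra.phi i y := by
    rw [phi_inf_phiBar, bot_sup_eq, inf_comm (LMAlgebra.phi i x), ← inf_sup_left, sup_comm,
      phi_sup_phiBar, inf_top_eq]
  have term (e : LMCon I A) {u v : A} (h : e.r u v) :
      e.r (LMAlgebra.phi i x ⊓ u ⊔ (LMAlgebra.phi i y ⊓ u ⊔ LMAlgebra.phi i x ⊓ LMAlgebra.phi i y))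
        (LMAlgebra.phi i x ⊓ v ⊔
          (LMAlgebra.phi i y ⊓ v ⊔ LMAlgebra.phi i x ⊓ LMAlgebra.phi i y)) :=
    e.sup (e.inf (e.iseqv.refl _) h)
      (e.sup (e.inf (e.iseqv.refl _) h) (e.iseqv.refl _))
  refine ⟨LMAlgebra.phi i x ⊓ LMAlgebra.phiBar i z ⊔
    (LMAlgebra.phi i y ⊓ LMAlgebra.phiBar i z ⊔ LMAlgebra.phi i x ⊓ LMAlgebra.phi i y), ?_, ?_⟩
  · have h := term c (c.phiBar i h₁)
    rwa [phiBar_phi, key] at h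
  · have h := term d (d.phiBar i h₂)
    rwa [phiBar_phi, sup_left_comm (LMAlgebra.phi i x ⊓ LMAlgebra.phiBar i y),
      inf_comm (LMAlgebra.phi i x) (LMAlgebra.phi i y), key y x,
      inf_comm (LMAlgebra.phi i y) (LMAlgebra.phi i x)] at h

/-- The congruence relating `x` and `y` when all `φ_i x` and `φ_i y` are related by the composite
of two congruences. -/
def phiComp (c d : LMCon I A) : LMCon I A where
  r x y := ∀ i : I, ∃ z, c.r (LMAlgebra.phi i x) z ∧ d.r z (LMAlgebra.phi i y)
  iseqv := by
    refine ⟨fun x i => ⟨_, c.iseqv.refl _, d.iseqv.refl _⟩, fun h i => ?_,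
      fun {x y z} h₁ h₂ i => ?_⟩
    · obtain ⟨z, hc, hd⟩ := h i
      exact exists_rel_rel_of_rel_rel c d hc hd
    · obtain ⟨u, hc₁, hd₁⟩ := h₁ i
      obtain ⟨v, hc₂, hd₂⟩ := h₂ i
      -- Moves the intermediate elements into the range of `phi i`, where the two relations can be
      -- swapped.
      replace hc₁ := c.phi i hc₁
      replace hd₁ := d.phi i hd₁
      replace hc₂ := c.phi i hc₂
      replace hd₂ := d.phi i hd₂
      rw [phi_phi] at hc₁ hd₁ hc₂ hd₂
      obtain ⟨w, hw₁, hw₂⟩ := exists_rel_rel_of_rel_rel d c hd₁ hc₂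
      exact ⟨w, c.iseqv.trans hc₁ (c.iseqv.symm hw₂), d.iseqv.trans (d.iseqv.symm hw₁) hd₂⟩
  inf h₁ h₂ i := by
    obtain ⟨u, hc₁, hd₁⟩ := h₁ i
    obtain ⟨v, hc₂, hd₂⟩ := h₂ i
    rw [map_inf, map_inf]
    exact ⟨u ⊓ v, c.inf hc₁ hc₂, d.inf hd₁ hd₂⟩
  sup h₁ h₂ i := by
    obtain ⟨u, hc₁, hd₁⟩ := h₁ i
    obtain ⟨v, hc₂, hd₂⟩ := h₂ i
    rw [map_sup, map_sup]
    exact ⟨u ⊔ v, c.sup hc₁ hc₂, d.sup hd₁ hd₂⟩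
  phi j _ _ h i := by
    rw [phi_phi, phi_phi]
    exact h j
  phiBar j x y h i := by
    obtain ⟨u, hc, hd⟩ := h j
    replace hc := c.phiBar j hc
    replace hd := d.phiBar j hd
    rw [phiBar_phi] at hc hd
    rw [phi_phiBar, phi_phiBar]
    exact ⟨_, hc, hd⟩

theorem le_phiComp_left (c d : LMCon I A) : c ≤ phiComp c d :=
  fun _ _ h i => ⟨_, c.phi i h, d.iseqv.refl _⟩

theorem le_phiComp_right (c d : LMCon I A) : d ≤ phiComp c d :=
  fun _ _ h i => ⟨_, c.iseqv.refl _, d.phi i h⟩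

/-- The congruence of equality. -/
def equality : LMCon I A where
  r := Eq
  iseqv := eq_equivalence
  inf h₁ h₂ := by rw [h₁, h₂]
  sup h₁ h₂ := by rw [h₁, h₂]
  phi i _ _ h := by rw [h]
  phiBar i _ _ h := by rw [h]

/-- The congruence relating any two elements. -/
def total : LMCon I A where
  r _ _ := True
  iseqv := ⟨fun _ => trivial, fun _ => trivial, fun _ _ => trivial⟩
  inf _ _ := trivial
  sup _ _ := trivial
  phi _ _ _ _ := trivial
  phiBar _ _ _ _ := trivial

/-- The congruence identifying elements with the same meet with an element `b` fixed by all `φ_i`. -/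
def ofFixed (b : A) (hb : ∀ i : I, LMAlgebra.phi i b = b) : LMCon I A where
  toLatticeCon := filterCon (Order.PFilter.principal b)
  phi i x y := by
    rintro ⟨f, hf, h⟩
    refine ⟨LMAlgebra.phi i f, ?_, by rw [← map_inf, h, map_inf]⟩
    rw [Order.PFilter.mem_principal] at hf ⊢
    simpa only [hb] using OrderHomClass.mono (LMAlgebra.phi i : BoundedLatticeHom A A) hf
  phiBar i x y := by
    rintro ⟨f, hf, h⟩
    have hp : LMAlgebra.phi i x ⊓ LMAlgebra.phi i f = LMAlgebra.phi i y ⊓ LMAlgebra.phi i f := by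
      rw [← map_inf, h, map_inf]
    -- Lying below `phiBar i y` is the same as being disjoint from its complement `phi i y`.
    have le {x y : A} (hp : LMAlgebra.phi i x ⊓ LMAlgebra.phi i f =
        LMAlgebra.phi i y ⊓ LMAlgebra.phi i f) :
        LMAlgebra.phiBar i x ⊓ LMAlgebra.phi i f ≤ LMAlgebra.phiBar i y := by
      rw [← (isCompl_phi_phiBar i y).symm.disjoint_right_iff, disjoint_iff, inf_assoc,
        inf_comm (LMAlgebra.phi i f), ← hp, ← inf_assoc, inf_comm (LMAlgebra.phiBar i x),
        phi_inf_phiBar, bot_inf_eq]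
    refine ⟨LMAlgebra.phi i f, ?_, le_antisymm (le_inf (le hp) inf_le_right)
      (le_inf (le hp.symm) inf_le_right)⟩
    rw [Order.PFilter.mem_principal] at hf ⊢
    simpa only [hb] using OrderHomClass.mono (LMAlgebra.phi i : BoundedLatticeHom A A) hf

end LMCon

theorem LatticeCon.eq_of_rel_iff {A : Type v} [Lattice A] {c d : LatticeCon A}
    (h : ∀ x y, c.r x y ↔ d.r x y) : c = d := by
  obtain ⟨s, _, _⟩ := c
  obtain ⟨t, _, _⟩ := d
  obtain rfl : s = t := Setoid.ext h
  rfl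

theorem filterCon_principal_iff {A : Type v} [DistribLattice A] {b x y : A} :
    (filterCon (Order.PFilter.principal b)).r x y ↔ x ⊓ b = y ⊓ b := by
  refine ⟨?_, fun h => ⟨b, Order.PFilter.mem_principal.2 le_rfl, h⟩⟩
  rintro ⟨f, hf, h⟩
  rw [Order.PFilter.mem_principal] at hf
  rw [← inf_eq_right.2 hf, ← inf_assoc, h, inf_assoc]

namespace LMCon

open LMAlgebra

variable {I : Type u} [LinearOrder I] {A : Type v} [DistribLattice A] [BoundedOrder A]
  [LMAlgebra I A]

theorem rel_of_rel_bot_top (d : LMCon I A) (h : d.r ⊥ ⊤) (x y : A) : d.r x y := by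
  have key (x : A) : d.r ⊥ x := by
    simpa using d.inf (d.iseqv.refl x) h
  exact d.iseqv.trans (d.iseqv.symm (key x)) (key y)

/-- By distributivity `x` is recovered from `x ⊓ b` and `x ⊓ b'`. A common upper bound relates `b`
and `b'` to `⊤`, hence `⊥ = b ⊓ b'` to `⊤`. -/
theorem isCompl_ofFixed {b b' : A} (h : IsCompl b b') (hb : ∀ i : I, LMAlgebra.phi i b = b)
    (hb' : ∀ i : I, LMAlgebra.phi i b' = b') : IsCompl (ofFixed b hb) (ofFixed b' hb') := by
  constructor
  · intro e h₁ h₂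
    refine le_trans (b := equality) (fun x y hxy => ?_)
      fun x y hxy => hxy ▸ (⊥ : LMCon I A).iseqv.refl x
    have e₁ := filterCon_principal_iff.1 (h₁ hxy)
    have e₂ := filterCon_principal_iff.1 (h₂ hxy)
    show x = y
    rw [← inf_top_eq x, ← inf_top_eq y, ← h.sup_eq_top, inf_sup_left, inf_sup_left, e₁, e₂]
  · intro e h₁ h₂ x y _
    refine e.rel_of_rel_bot_top ?_ x y
    have e₁ : e.r b ⊤ := h₁ (filterCon_principal_iff.2 (by simp))
    have e₂ : e.r b' ⊤ := h₂ (filterCon_principal_iff.2 (by simp))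
    simpa [h.inf_eq_bot] using e.inf e₁ e₂

theorem eq_filterCon_of_isCompl {c d : LMCon I A} (h : IsCompl c d) (i : I) :
    ∃ a : A, c.toLatticeCon = filterCon (Order.PFilter.principal (LMAlgebra.phi i a)) := by
  have htop : total ≤ phiComp c d :=
    le_top.trans (h.codisjoint (le_phiComp_left c d) (le_phiComp_right c d))
  obtain ⟨z, hc, hd⟩ := htop (show (total : LMCon I A).r ⊥ ⊤ from trivial) i
  have hinj {x y : A} (h₁ : c.r x y) (h₂ : d.r x y) : x = y := by
    have hle : sInf {c, d} ≤ (⊥ : LMCon I A) :=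
      h.disjoint (sInf_le (by simp)) (sInf_le (by simp))
    exact (hle.trans bot_le : _ ≤ (equality : LMCon I A)) (by rintro e (rfl | rfl) <;> assumption)
  have hc' : c.r ⊤ (LMAlgebra.phiBar i z) := by
    have := c.phiBar i hc
    rwa [phiBar_phi, show LMAlgebra.phiBar i (⊥ : A) = ⊤ by
      simpa using phi_sup_phiBar i (⊥ : A)] at this
  have hd' : d.r (LMAlgebra.phiBar i z) ⊥ := by
    have := d.phiBar i hd
    rwa [phiBar_phi, show LMAlgebra.phiBar i (⊤ : A) = ⊥ by
      simpa using phi_inf_phiBar i (⊤ : A)] at this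
  -- This element is `c`-related to `⊤` and `d`-related to `⊥`. So meeting with it does not change
  -- `c`-classes and sends everything to the `d`-class of `⊥`, where `c` is equality by `hinj`.
  refine ⟨LMAlgebra.phiBar i z, ?_⟩
  rw [phi_phiBar]
  refine LatticeCon.eq_of_rel_iff fun x y => ?_
  refine Iff.trans ?_ filterCon_principal_iff.symm
  have hcx (x : A) : c.r x (x ⊓ LMAlgebra.phiBar i z) := by
    simpa using c.inf (c.iseqv.refl x) hc'
  have hdx (x : A) : d.r (x ⊓ LMAlgebra.phiBar i z) ⊥ := by
    simpa using d.inf (d.iseqv.refl x) hd'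
  constructor
  · intro hxy
    exact hinj (c.inf hxy (c.iseqv.refl _)) (d.iseqv.trans (hdx x) (d.iseqv.symm (hdx y)))
  · intro hxy
    exact c.iseqv.trans (hxy ▸ hcx x) (c.iseqv.symm (hcx y))

end LMCon

theorem mainTheorem11 {I : Type u} [LinearOrder I] [Nonempty I]
    {A : Type v} [DistribLattice A] [BoundedOrder A] [LMAlgebra I A] (c : LMCon I A) :
    c.IsBoolean ↔
      ∃ (a : A) (i : I),
        c.toLatticeCon = filterCon (Order.PFilter.principal (LMAlgebra.phi i a)) := by
  constructor
  · rintro ⟨d, h⟩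
    obtain ⟨i⟩ := ‹Nonempty I›
    obtain ⟨a, ha⟩ := LMCon.eq_filterCon_of_isCompl h i
    exact ⟨a, i, ha⟩
  · rintro ⟨a, i, h⟩
    have hc : c = LMCon.ofFixed (LMAlgebra.phi i a) fun j => LMAlgebra.phi_phi j i a := by
      obtain ⟨c, _, _⟩ := c
      subst h
      rfl
    rw [hc]
    exact ⟨_, LMCon.isCompl_ofFixed (LMAlgebra.isCompl_phi_phiBar i a) _
      fun j => LMAlgebra.phi_phiBar j i a⟩
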